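/- Let $N\ge 1$, $s\in(0,1)$ and $2\le p<N/s$. Put $p^*=\frac{Np}{N-sp}$, $$[u]_{s,p}=\Big(\int_{\mathbb R^N}\int_{\mathbb R^N}\frac{|u(x)-u(y)|^p}{|x-y|^{N+sp}}\,dx\,dy\Big)^{1/p},\qquad D^{s,p}(\mathbb R^N)=\{u\in L^{p^*}(\mathbb R^N): [u]_{s,p}<\infty\},$$ and write $\|\cdot\|_r$ for the norm of $L^r(\mathbb R^N)$. For $f:\mathbb R^N\times\mathbb R\to\mathbb R$, a function $u\in D^{s,p}(\mathbb R^N)$ is called a weak solution of $(-\Delta_p)^s u=f(x,u)$ in $\mathbb R^N$ if for every $v\in D^{s,p}(\mathbb R^N)$ the function $f(\cdot,u)v$ is integrable and $$\int_{\mathbb R^N}\int_{\mathbb R^N}\frac{|u(x)-u(y)|^{p-2}(u(x)-u(y))(v(x)-v(y))}{|x-y|^{N+sp}}\,dx\,dy=\int_{\mathbb R^N}f(x,u)\,v\,dx .$$ **Theorem.** Let $q>N/s$ and $\beta>p$ be real numbers, let $b_2\in L^{q/p}(\mathbb R^N)$ and $b_3\in L^{\beta/(p-1)}(\mathbb R^N)\cap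 L^\infty(\mathbb R^N)$, and suppose that, for a.e. $x\in\mathbb R^N$ and all $t\in\mathbb R$, $$|f(x,t)|\le b_2(x)|t|^{p-1}+b_3(x).$$ Let $u\in D^{s,p}(\mathbb R^N)$ be a weak solution of $(-\Delta_p)^s u=f(x,u)$ in $\mathbb R^N$ with $u\in L^\beta(\mathbb R^N)$. Then $u\in L^\infty(\mathbb R^N)$ and $$\|u\|_\infty\le C\max\big\{\|u\|_\beta,\ \|u\|_\beta^{\theta_0}\big\},$$ where $\theta_0=\theta_0(p,\beta,N,s)\in(0,1]$ depends only on $p,\beta,N,s$, and $C=C\big(p,q,N,s,\|b_2\|_{q/p},\|b_3\|\big)$, with $\|b_3\|:=\|b_3\|_{\beta/(p-1)}+\|b_3\|_\infty$, is finite, depends only on the listed quantities, and is nondecreasing in $\|b_2\|_{q/p}$ and in $\|b_3\|$. -/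

import Mathlib

open MeasureTheory
open scoped ENNReal NNReal

/-- The Euclidean space `ℝ^N`. -/
abbrev RN (N : ℕ) : Type := EuclideanSpace ℝ (Fin N)

/-- The Gagliardo seminorm
`[u]_{s,p} = (∬ |u(x) - u(y)|^p / |x - y|^{N + s p} dx dy)^{1/p}`, with values in `[0, ∞]`. -/
noncomputable def gagliardo (N : ℕ) (s p : ℝ) (u : RN N → ℝ) : ℝ≥0∞ :=
  (∫⁻ z : RN N × RN N,
    ENNReal.ofReal (|u z.1 - u z.2| ^ p / ‖z.1 - z.2‖ ^ ((N : ℝ) + s * p))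
      ∂(volume.prod volume)) ^ (1 / p)

/-- The fractional critical Sobolev exponent `p^* = N p / (N - s p)`. -/
noncomputable def critExp (N : ℕ) (s p : ℝ) : ℝ := (N : ℝ) * p / ((N : ℝ) - s * p)

/-- Membership in the homogeneous fractional Sobolev space
`D^{s,p}(ℝ^N) = {u ∈ L^{p^*}(ℝ^N) : [u]_{s,p} < ∞}`. -/
def MemD (N : ℕ) (s p : ℝ) (u : RN N → ℝ) : Prop :=
  MemLp u (ENNReal.ofReal (critExp N s p)) volume ∧ gagliardo N s p u < ∞

/-- The pairing `⟨(-Δ_p)^s u, v⟩`. For `u, v` in `D^{s,p}(ℝ^N)` and `p ≥ 2` the integrand is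
integrable by Hölder's inequality. -/
noncomputable def fracPLaplacePairing (N : ℕ) (s p : ℝ) (u v : RN N → ℝ) : ℝ :=
  ∫ z : RN N × RN N,
    |u z.1 - u z.2| ^ (p - 2) * (u z.1 - u z.2) * (v z.1 - v z.2) /
      ‖z.1 - z.2‖ ^ ((N : ℝ) + s * p) ∂(volume.prod volume)

/-- `u ∈ D^{s,p}(ℝ^N)` is a weak solution of `(-Δ_p)^s u = f(x, u)` in `ℝ^N`: for every test
function `v ∈ D^{s,p}(ℝ^N)` the integral of `f(x, u) v` exists and equals `⟨(-Δ_p)^s u, v⟩`. -/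
def IsWeakSolution (N : ℕ) (s p : ℝ) (f : RN N → ℝ → ℝ) (u : RN N → ℝ) : Prop :=
  MemD N s p u ∧
    ∀ v : RN N → ℝ, MemD N s p v →
      Integrable (fun x => f x (u x) * v x) volume ∧
        fracPLaplacePairing N s p u v = ∫ x, f x (u x) * v x

/-! The proof is a De Giorgi iteration on superlevel sets. Put `σ = sp/N`, `τ = 1 - σ = p/p^*`, `P =
p^*`, `r = q/p` and `δ = σ - 1/r`; the condition `q > N/s` says exactly that `δ > 0`.

Test the equation with `w = (u - h)_+`, where `k ≤ h ≤ 2k`. Since `p ≥ 2`, the pairing dominates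
`[w]^p`, and the Sobolev inequality (`exists_fractional_sobolev`) turns this into control of
`‖w‖_P^p`. On `A = {u > h}`, both source terms are bounded by multiples of `max(w, k)^p`, so Hölder
(`lintegral_source_mul_posTrunc_le`) gives `‖w‖_P^p ≤ S E (‖w‖_P^p + k^p |A|^τ)`, where `E` is a
combination of `|A|^δ` and `|A|^σ`. When `2 S E ≤ 1` the first term is absorbed. Chebyshev between
consecutive levels then yields a recursion for the measures that is superlinear because of the
factor `E`. If `|{u > k}|` is small enough, the measures decay geometrically along levels increasing
to `2k`, so `u ≤ 2k` a.e. (`IsWeakSolution.measure_superlevel_eq_zero`).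

It remains to choose `k = K T` with `T = max(M, M^θ)`, `M = ‖u‖_β`. Chebyshev in `L^β` makes the
initial measure small (`measure_mul_rpow_le_one`); the exponent `θ` compensates the factor `k^(1-p)`
carried by the `b₃` term, and `β > p` allows `K` to be chosen independently of `β`. The lower bound
follows by applying the same result to `-u`. -/

/-- Hölder's inequality with three factors, the third being the constant `1`. -/
theorem lintegral_mul_rpow_le_measure_univ {α : Type*} [MeasurableSpace α] {μ : Measure α}
    {B Z : α → ℝ≥0∞} (hB : AEMeasurable B μ) (hZ : AEMeasurable Z μ) {r p P δ τ : ℝ}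
    (hr : 0 < r) (hδ : 0 ≤ δ) (hτ : 0 ≤ τ) (hsum : 1 / r + δ + τ = 1)
    (hPτ : P * τ = p) :
    ∫⁻ x, B x * Z x ^ p ∂μ ≤
      (∫⁻ x, B x ^ r ∂μ) ^ (1 / r) * μ Set.univ ^ δ * (∫⁻ x, Z x ^ P ∂μ) ^ τ := by
  have h := ENNReal.lintegral_prod_norm_pow_le (μ := μ) (Finset.univ : Finset (Fin 3))
    (f := ![fun x => B x ^ r, fun _ => 1, fun x => Z x ^ P]) (p := ![1 / r, δ, τ])
    (by
      intro i _
      fin_cases i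
      · exact hB.pow_const r
      · exact aemeasurable_const
      · exact hZ.pow_const P)
    (by simpa [Fin.sum_univ_three] using hsum)
    (by
      intro i _
      fin_cases i
      · simpa using hr.le
      · simpa using hδ
      · simpa using hτ)
  simp only [Fin.prod_univ_three, Matrix.cons_val_zero, Matrix.cons_val_one, Matrix.cons_val,
    ENNReal.one_rpow, mul_one, lintegral_one] at h
  convert h using 3 with x
  · rw [← ENNReal.rpow_mul, ← ENNReal.rpow_mul, hPτ, mul_one_div_cancel hr.ne', ENNReal.rpow_one]

theorem lintegral_rpow_le_measure_univ {α : Type*} [MeasurableSpace α] {μ : Measure α}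
    {Z : α → ℝ≥0∞} (hZ : AEMeasurable Z μ) {p P σ τ : ℝ}
    (hσ : 0 < σ) (hτ : 0 ≤ τ) (hsum : σ + τ = 1) (hPτ : P * τ = p) :
    ∫⁻ x, Z x ^ p ∂μ ≤ μ Set.univ ^ σ * (∫⁻ x, Z x ^ P ∂μ) ^ τ := by
  have h := lintegral_mul_rpow_le_measure_univ (B := fun _ => 1) (δ := 0) aemeasurable_const hZ
    (one_div_pos.2 hσ) le_rfl hτ (by rw [one_div_one_div, add_zero, hsum]) hPτ
  simpa using h

/-! ### Fractional Sobolev inequality. -/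

/-- The Gagliardo kernel `|u(x) - u(y)|^p / |x - y|^{N + s p}`. -/
noncomputable def gagliardoKernel (N : ℕ) (s p : ℝ) (u : RN N → ℝ) (z : RN N × RN N) : ℝ≥0∞ :=
  ENNReal.ofReal (|u z.1 - u z.2| ^ p / ‖z.1 - z.2‖ ^ ((N : ℝ) + s * p))

theorem aemeasurable_gagliardoKernel {N : ℕ} {s p : ℝ} {u : RN N → ℝ} (hu : AEMeasurable u) :
    AEMeasurable (gagliardoKernel N s p u) (volume.prod volume) := by
  have h1 : AEMeasurable (fun z : RN N × RN N => u z.1) (volume.prod volume) := hu.comp_fst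
  have h2 : AEMeasurable (fun z : RN N × RN N => u z.2) (volume.prod volume) := hu.comp_snd
  unfold gagliardoKernel
  refine AEMeasurable.ennreal_ofReal (AEMeasurable.div ?_ ?_)
  · exact ((h1.sub h2).abs).pow_const p
  · exact (((measurable_fst.sub measurable_snd).norm).pow_const _).aemeasurable

theorem enorm_sub_rpow_le_gagliardoKernel {N : ℕ} {s p : ℝ} (hs : 0 < s) (hp : 0 < p)
    (u : RN N → ℝ) {x y : RN N} {r : ℝ} (hr : 0 < r) (hxy : dist y x ≤ r) :
    ‖u x - u y‖ₑ ^ p ≤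
      ENNReal.ofReal (r ^ ((N : ℝ) + s * p)) * gagliardoKernel N s p u (x, y) := by
  have he : 0 < (N : ℝ) + s * p := by positivity
  rw [gagliardoKernel, ← ENNReal.ofReal_mul (by positivity), ← ofReal_norm,
    ENNReal.ofReal_rpow_of_nonneg (norm_nonneg _) hp.le, Real.norm_eq_abs]
  apply ENNReal.ofReal_le_ofReal
  rcases eq_or_ne x y with rfl | hne
  · simp [Real.zero_rpow hp.ne']
  have hd : 0 < ‖x - y‖ := norm_pos_iff.2 (sub_ne_zero.2 hne)
  have hle : ‖x - y‖ ≤ r := by rwa [← dist_eq_norm, dist_comm]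
  have := Real.rpow_le_rpow hd.le hle he.le
  rw [mul_div_assoc', le_div_iff₀ (by positivity), mul_comm]
  gcongr

/-- Averaging over a ball of measure comparable to `t` bounds a function pointwise by its
fractional difference quotient and its `L^P` norm. -/
theorem exists_enorm_rpow_le_averaged {N : ℕ} {s p P σ τ : ℝ} (hN : 0 < N) (hs : 0 < s)
    (hp : 1 ≤ p) (hσ : 0 < σ) (hτ : 0 ≤ τ) (hsum : σ + τ = 1) (hPτ : P * τ = p)
    (hσN : σ * N = s * p) :
    ∃ C : ℝ≥0∞, C ≠ ∞ ∧ ∀ w : RN N → ℝ, AEMeasurable w → ∀ x : RN N, ∀ t : ℝ≥0∞, t ≠ 0 → t ≠ ∞ →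
      ‖w x‖ₑ ^ p ≤ C * (t ^ σ * (∫⁻ y, gagliardoKernel N s p w (x, y)) +
        t ^ (-τ) * (∫⁻ y, ‖w y‖ₑ ^ P) ^ τ) := by
  have : Nonempty (Fin N) := ⟨⟨0, hN⟩⟩
  have : Nontrivial (RN N) := inferInstance
  set ω : ℝ≥0∞ := volume (Metric.ball (0 : RN N) 1) with hω
  have hω0 : ω ≠ 0 := (Metric.measure_ball_pos volume _ one_pos).ne'
  have hωt : ω ≠ ∞ := measure_ball_lt_top.ne
  have hp0 : 0 < p := by linarith
  -- `2 ^ (p - 1)` comes from convexity of the `p`-th power; the two powers of the unit ball's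
  -- volume come from averaging the two terms.
  refine ⟨2 ^ (p - 1) * (ω⁻¹ + ω ^ (-τ)), ?_, ?_⟩
  · refine ENNReal.mul_ne_top (ENNReal.rpow_ne_top_of_nonneg (by linarith) (by simp)) ?_
    exact ENNReal.add_ne_top.2 ⟨ENNReal.inv_ne_top.2 hω0, ENNReal.rpow_ne_top_of_ne_zero hω0 hωt⟩
  intro w hw x t ht0 htt
  set G := ∫⁻ y, gagliardoKernel N s p w (x, y) with hG
  set X := ∫⁻ y, ‖w y‖ₑ ^ P with hX
  have hNr : (0 : ℝ) < N := by exact_mod_cast hN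
  have htpos : 0 < t.toReal := ENNReal.toReal_pos ht0 htt
  -- This radius gives the ball volume `t * ω`, and `r ^ (N + sp) = t ^ (1 + σ)`.
  set r : ℝ := t.toReal ^ (1 / (N : ℝ)) with hr
  have hr0 : 0 < r := Real.rpow_pos_of_pos htpos _
  set D := Metric.ball x r with hD
  have hvol : volume D = t * ω := by
    rw [hD, Measure.addHaar_ball _ _ hr0.le, finrank_euclideanSpace, Fintype.card_fin, hr,
      ← Real.rpow_natCast, ← Real.rpow_mul htpos.le, one_div_mul_cancel hNr.ne', Real.rpow_one,
      ENNReal.ofReal_toReal htt]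
  have hrp : ENNReal.ofReal (r ^ ((N : ℝ) + s * p)) = t ^ (1 + σ) := by
    rw [hr, ← Real.rpow_mul htpos.le, ← ENNReal.ofReal_rpow_of_pos htpos, ENNReal.ofReal_toReal htt]
    congr 1
    rw [← hσN]; field_simp
  have hptw : ∀ y ∈ D, ‖w x‖ₑ ^ p ≤
      2 ^ (p - 1) * (t ^ (1 + σ) * gagliardoKernel N s p w (x, y) + ‖w y‖ₑ ^ p) := by
    intro y hy
    calc ‖w x‖ₑ ^ p = ‖(w x - w y) + w y‖ₑ ^ p := by rw [sub_add_cancel]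
      _ ≤ (‖w x - w y‖ₑ + ‖w y‖ₑ) ^ p := by gcongr; exact enorm_add_le _ _
      _ ≤ 2 ^ (p - 1) * (‖w x - w y‖ₑ ^ p + ‖w y‖ₑ ^ p) :=
        ENNReal.rpow_add_le_mul_rpow_add_rpow _ _ hp
      _ ≤ _ := by
        gcongr
        rw [← hrp]
        exact enorm_sub_rpow_le_gagliardoKernel hs hp0 w hr0 (Metric.mem_ball.1 hy).le
  have hwp : AEMeasurable (fun y => ‖w y‖ₑ ^ p) := hw.enorm.pow_const p
  have h2 : (2 : ℝ≥0∞) ^ (p - 1) ≠ ∞ := ENNReal.rpow_ne_top_of_nonneg (by linarith) (by simp)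
  have hint : ‖w x‖ₑ ^ p * (t * ω) ≤ 2 ^ (p - 1) * (t ^ (1 + σ) * G + (t * ω) ^ σ * X ^ τ) := by
    calc ‖w x‖ₑ ^ p * (t * ω) = ∫⁻ _ in D, ‖w x‖ₑ ^ p := by rw [setLIntegral_const, hvol]
      _ ≤ ∫⁻ y in D, 2 ^ (p - 1) * (t ^ (1 + σ) * gagliardoKernel N s p w (x, y) + ‖w y‖ₑ ^ p) :=
        setLIntegral_mono' measurableSet_ball hptw
      _ = 2 ^ (p - 1) * (t ^ (1 + σ) * (∫⁻ y in D, gagliardoKernel N s p w (x, y)) +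
            ∫⁻ y in D, ‖w y‖ₑ ^ p) := by
        rw [lintegral_const_mul' _ _ h2, lintegral_add_right' _ hwp.restrict,
          lintegral_const_mul' _ _ (ENNReal.rpow_ne_top_of_nonneg (by linarith) htt)]
      _ ≤ _ := by
        gcongr
        · exact setLIntegral_le_lintegral _ _
        · refine (lintegral_rpow_le_measure_univ hw.enorm.restrict hσ hτ hsum hPτ).trans ?_
          rw [Measure.restrict_apply_univ, hvol]
          gcongr
          exact setLIntegral_le_lintegral _ _
  have hv0 : t * ω ≠ 0 := mul_ne_zero ht0 hω0
  have hvt : t * ω ≠ ∞ := ENNReal.mul_ne_top htt hωt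
  have e1 : t ^ (1 + σ) * (t * ω)⁻¹ = ω⁻¹ * t ^ σ := by
    rw [ENNReal.mul_inv (Or.inl ht0) (Or.inl htt), ← ENNReal.rpow_neg_one t, ← mul_assoc,
      ← ENNReal.rpow_add _ _ ht0 htt, mul_comm]
    congr 2; ring
  have e2 : (t * ω) ^ σ * (t * ω)⁻¹ = ω ^ (-τ) * t ^ (-τ) := by
    rw [← ENNReal.rpow_neg_one (t * ω), ← ENNReal.rpow_add _ _ hv0 hvt,
      ENNReal.mul_rpow_of_ne_zero ht0 hω0, mul_comm]
    congr 2 <;> linarith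
  calc ‖w x‖ₑ ^ p = ‖w x‖ₑ ^ p * (t * ω) * (t * ω)⁻¹ := by
        rw [mul_assoc, ENNReal.mul_inv_cancel hv0 hvt, mul_one]
    _ ≤ 2 ^ (p - 1) * (t ^ (1 + σ) * G + (t * ω) ^ σ * X ^ τ) * (t * ω)⁻¹ := by gcongr
    _ = 2 ^ (p - 1) * ((t ^ (1 + σ) * (t * ω)⁻¹) * G + ((t * ω) ^ σ * (t * ω)⁻¹) * X ^ τ) := by
      ring
    _ = 2 ^ (p - 1) * (ω⁻¹ * (t ^ σ * G) + ω ^ (-τ) * (t ^ (-τ) * X ^ τ)) := by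
      rw [e1, e2]; ring
    _ ≤ 2 ^ (p - 1) * ((ω⁻¹ + ω ^ (-τ)) * (t ^ σ * G) +
          (ω⁻¹ + ω ^ (-τ)) * (t ^ (-τ) * X ^ τ)) := by
      gcongr
      · exact le_self_add
      · exact le_add_self
    _ = _ := by ring

/-- The fractional Sobolev inequality, for functions that are known to lie in the critical
Lebesgue space. -/
theorem exists_fractional_sobolev {N : ℕ} {s p P σ τ : ℝ} (hN : 0 < N) (hs : 0 < s)
    (hp : 1 ≤ p) (hP : 0 < P) (hσ : 0 < σ) (hτ : 0 < τ) (hsum : σ + τ = 1) (hPτ : P * τ = p)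
    (hσN : σ * N = s * p) :
    ∃ S : ℝ≥0, ∀ w : RN N → ℝ, AEMeasurable w → (∫⁻ y, ‖w y‖ₑ ^ P) ≠ ∞ →
      (∫⁻ y, ‖w y‖ₑ ^ P) ^ τ ≤ S * ∫⁻ z, gagliardoKernel N s p w z ∂(volume.prod volume) := by
  obtain ⟨C, hC, hpt⟩ := exists_enorm_rpow_le_averaged hN hs hp hσ hτ.le hsum hPτ hσN
  have hC' : (2 * C) ^ (1 / τ) ≠ ∞ :=
    ENNReal.rpow_ne_top_of_nonneg (by positivity) (ENNReal.mul_ne_top (by simp) hC)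
  refine ⟨((2 * C) ^ (1 / τ)).toNNReal, fun w hw hXt => ?_⟩
  rw [ENNReal.coe_toNNReal hC']
  set X := ∫⁻ y, ‖w y‖ₑ ^ P with hX
  rcases eq_or_ne X 0 with hX0 | hX0
  · rw [hX0, ENNReal.zero_rpow_of_pos hτ]; exact zero_le
  have hXσ0 : X ^ σ ≠ 0 := (ENNReal.rpow_pos (pos_iff_ne_zero.2 hX0) hXt).ne'
  have hXσt : X ^ σ ≠ ∞ := ENNReal.rpow_ne_top_of_nonneg hσ.le hXt
  have key : ∀ x, ‖w x‖ₑ ^ P ≤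
      (2 * C) ^ (1 / τ) * X ^ σ * ∫⁻ y, gagliardoKernel N s p w (x, y) := by
    intro x
    -- The optimal `t = X ^ τ / G` is not admissible if the inner integral `G` is `0` or `∞`. A
    -- finite `g > G` avoids both cases; `g` is brought down to `G` afterwards.
    have hlim : ∀ g : ℝ≥0∞, g ≠ ∞ → (∫⁻ y, gagliardoKernel N s p w (x, y)) < g →
        ‖w x‖ₑ ^ P ≤ (2 * C) ^ (1 / τ) * X ^ σ * g := by
      intro g hgt hg
      have hg0 : g ≠ 0 := (lt_of_le_of_lt (zero_le) hg).ne'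
      have hXτ0 : X ^ τ ≠ 0 := (ENNReal.rpow_pos (pos_iff_ne_zero.2 hX0) hXt).ne'
      have hXτt : X ^ τ ≠ ∞ := ENNReal.rpow_ne_top_of_nonneg hτ.le hXt
      have hgi0 : g⁻¹ ≠ 0 := ENNReal.inv_ne_zero.2 hgt
      have hgit : g⁻¹ ≠ ∞ := ENNReal.inv_ne_top.2 hg0
      -- This `t` equates the two terms of the averaged bound: `e1` and `e2` have the same
      -- right-hand side.
      have h := hpt w hw x (X ^ τ * g⁻¹) (mul_ne_zero hXτ0 hgi0) (ENNReal.mul_ne_top hXτt hgit)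
      have e1 : (X ^ τ * g⁻¹) ^ σ * g = X ^ (τ * σ) * g ^ τ := by
        rw [ENNReal.mul_rpow_of_ne_zero hXτ0 hgi0, ← ENNReal.rpow_mul, ENNReal.inv_rpow,
          ← ENNReal.rpow_neg, mul_assoc]
        congr 1
        nth_rw 2 [← ENNReal.rpow_one g]
        rw [← ENNReal.rpow_add _ _ hg0 hgt]
        congr 1; linarith
      have e2 : (X ^ τ * g⁻¹) ^ (-τ) * X ^ τ = X ^ (τ * σ) * g ^ τ := by
        rw [ENNReal.mul_rpow_of_ne_zero hXτ0 hgi0, ← ENNReal.rpow_mul, ENNReal.inv_rpow,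
          ← ENNReal.rpow_neg, neg_neg, mul_right_comm, ← ENNReal.rpow_add _ _ hX0 hXt]
        congr 2
        rw [show σ = 1 - τ by linarith]; ring
      have h' : ‖w x‖ₑ ^ p ≤ 2 * C * (X ^ (τ * σ) * g ^ τ) := by
        calc ‖w x‖ₑ ^ p ≤ C * ((X ^ τ * g⁻¹) ^ σ * g + (X ^ τ * g⁻¹) ^ (-τ) * X ^ τ) := by
              refine h.trans ?_
              gcongr
          _ = _ := by rw [e1, e2]; ring
      have h'' := ENNReal.rpow_le_rpow h' (z := 1 / τ) (by positivity)
      have e3 : (‖w x‖ₑ ^ p) ^ (1 / τ) = ‖w x‖ₑ ^ P := by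
        rw [← ENNReal.rpow_mul, ← hPτ, mul_assoc, mul_one_div_cancel hτ.ne', mul_one]
      have e4 : (X ^ (τ * σ) * g ^ τ) ^ (1 / τ) = X ^ σ * g := by
        rw [ENNReal.mul_rpow_of_nonneg _ _ (by positivity), ← ENNReal.rpow_mul,
          ← ENNReal.rpow_mul, mul_one_div_cancel hτ.ne', ENNReal.rpow_one, mul_right_comm τ σ,
          mul_one_div_cancel hτ.ne', one_mul]
      rw [e3, ENNReal.mul_rpow_of_nonneg _ _ (by positivity), e4, ← mul_assoc] at h''
      exact h''
    have hc0 : (2 * C) ^ (1 / τ) * X ^ σ ≠ ∞ := ENNReal.mul_ne_top hC' hXσt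
    set c := (2 * C) ^ (1 / τ) * X ^ σ
    set G := ∫⁻ y, gagliardoKernel N s p w (x, y)
    rcases eq_or_ne G ∞ with hG | hG
    -- An infinite `G` makes the bound trivial unless `c = 0`; that would force `C = 0`, hence `w =
    -- 0` everywhere, against `X ≠ 0`.
    · have hcne : c ≠ 0 := by
        intro hc
        have hC0 : C = 0 := by
          have := (mul_eq_zero.1 hc).resolve_right hXσ0
          rw [ENNReal.rpow_eq_zero_iff] at this
          rcases this with h | h
          · simpa using h.1
          · exact absurd h.2 (by simp [hτ.le])
        have hz : ∀ y, ‖w y‖ₑ ^ P = 0 := by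
          intro y
          have := hpt w hw y 1 (by simp) (by simp)
          rw [hC0, zero_mul, nonpos_iff_eq_zero, ENNReal.rpow_eq_zero_iff_of_pos (by linarith)]
            at this
          rw [this, ENNReal.zero_rpow_of_pos hP]
        exact hX0 (by simp [hX, hz])
      rw [hG, ENNReal.mul_top hcne]; exact le_top
    · refine ENNReal.le_of_forall_pos_le_add fun ε hε _ => ?_
      rcases eq_or_ne c 0 with hc | hc
      · have := hlim (G + 1) (by simp [hG]) (ENNReal.lt_add_right hG one_ne_zero)
        rw [hc, zero_mul] at this ⊢
        exact this.trans (zero_le)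
      have hεc : (ε : ℝ≥0∞) / c ≠ 0 := ENNReal.div_ne_zero.2 ⟨by simpa using hε.ne', hc0⟩
      have := hlim (G + ε / c) (ENNReal.add_ne_top.2 ⟨hG, ENNReal.div_ne_top (by simp) hc⟩)
        (ENNReal.lt_add_right hG hεc)
      rwa [mul_add, ENNReal.mul_div_cancel hc hc0] at this
  have hI : X ≤ (2 * C) ^ (1 / τ) * X ^ σ *
      ∫⁻ z, gagliardoKernel N s p w z ∂(volume.prod volume) := by
    rw [lintegral_prod _ (aemeasurable_gagliardoKernel hw),
      ← lintegral_const_mul' _ _ (ENNReal.mul_ne_top hC' hXσt)]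
    exact lintegral_mono key
  -- Cancelling `X ^ σ` is where finiteness of the `L^P` norm is indispensable.
  have hXX : X = X ^ τ * X ^ σ := by
    rw [← ENNReal.rpow_add _ _ hX0 hXt, add_comm, hsum, ENNReal.rpow_one]
  nth_rw 1 [hXX] at hI
  rw [mul_right_comm] at hI
  exact (ENNReal.mul_le_mul_iff_left hXσ0 hXσt).1 hI

/-! ### Truncations and the energy inequality. -/

theorem gagliardo_lt_top_iff {N : ℕ} {s p : ℝ} (hp : 0 < p) {u : RN N → ℝ} :
    gagliardo N s p u < ∞ ↔
      ∫⁻ z, gagliardoKernel N s p u z ∂(volume.prod volume) < ∞ := by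
  rw [gagliardo, ENNReal.rpow_lt_top_iff_of_pos (by positivity)]
  rfl

/-- The truncation `(u - h)_+`. -/
def posTrunc {α : Type*} (u : α → ℝ) (h : ℝ) (x : α) : ℝ := max (u x - h) 0

theorem abs_posTrunc_sub_le {α : Type*} (u : α → ℝ) (h : ℝ) (x y : α) :
    |posTrunc u h x - posTrunc u h y| ≤ |u x - u y| := by
  have := abs_max_sub_max_le_abs (u x - h) (u y - h) 0
  simpa [posTrunc] using this

/-- The map `t ↦ (t - h)_+` is nondecreasing and 1-Lipschitz, so its increment has the sign of `u x
- u y` and is no larger in modulus. -/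
theorem sq_posTrunc_sub_le {α : Type*} (u : α → ℝ) (h : ℝ) (x y : α) :
    (posTrunc u h x - posTrunc u h y) ^ 2 ≤ (u x - u y) * (posTrunc u h x - posTrunc u h y) := by
  unfold posTrunc
  rcases max_cases (u x - h) 0 with ⟨h1, h1'⟩ | ⟨h1, h1'⟩ <;>
    rcases max_cases (u y - h) 0 with ⟨h2, h2'⟩ | ⟨h2, h2'⟩ <;> rw [h1, h2] <;> nlinarith

theorem aemeasurable_posTrunc {α : Type*} [MeasurableSpace α] {μ : Measure α} {u : α → ℝ}
    (hu : AEMeasurable u μ) (h : ℝ) : AEMeasurable (posTrunc u h) μ :=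
  (hu.sub_const h).max aemeasurable_const

/-- Makes the truncation an admissible test function; `h ≥ 0` gives `(u - h)_+ ≤ |u|`, hence
membership in `L^{p^*}`. -/
theorem MemD.posTrunc {N : ℕ} {s p : ℝ} (hp : 0 < p) {u : RN N → ℝ} (hu : MemD N s p u) {h : ℝ}
    (hh : 0 ≤ h) : MemD N s p (posTrunc u h) := by
  refine ⟨hu.1.mono (aemeasurable_posTrunc hu.1.1.aemeasurable h).aestronglyMeasurable ?_, ?_⟩
  · refine Filter.Eventually.of_forall fun x => ?_
    rw [Real.norm_eq_abs, Real.norm_eq_abs, _root_.posTrunc, abs_of_nonneg (le_max_right _ _)]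
    exact max_le (by linarith [le_abs_self (u x)]) (abs_nonneg _)
  · rw [gagliardo_lt_top_iff hp]
    refine lt_of_le_of_lt (lintegral_mono fun z => ?_) ((gagliardo_lt_top_iff hp).1 hu.2)
    unfold gagliardoKernel
    have := abs_posTrunc_sub_le u h z.1 z.2
    gcongr

/-- Testing the nonlocal operator with `(u - h)_+` controls the Gagliardo energy of `(u - h)_+`. -/
theorem lintegral_gagliardoKernel_posTrunc_le {N : ℕ} {s p : ℝ} (hp : 2 ≤ p) {u : RN N → ℝ}
    (hu : MemD N s p u) (h : ℝ) :
    ∫⁻ z, gagliardoKernel N s p (posTrunc u h) z ∂(volume.prod volume) ≤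
      ENNReal.ofReal (fracPLaplacePairing N s p u (posTrunc u h)) := by
  have hp0 : 0 < p := by linarith
  have hum := hu.1.1.aemeasurable
  have hwm := aemeasurable_posTrunc hum h
  -- Here `p ≥ 2` enters: `|c| ^ (p - 2) ≤ |u z.1 - u z.2| ^ (p - 2)` needs a nonnegative exponent.
  have hlow : ∀ z : RN N × RN N, |posTrunc u h z.1 - posTrunc u h z.2| ^ p ≤
      |u z.1 - u z.2| ^ (p - 2) * (u z.1 - u z.2) *
        (posTrunc u h z.1 - posTrunc u h z.2) := by
    intro z
    have h1 := abs_posTrunc_sub_le u h z.1 z.2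
    have h2 := sq_posTrunc_sub_le u h z.1 z.2
    set c := posTrunc u h z.1 - posTrunc u h z.2
    calc |c| ^ p = |c| ^ (p - 2) * c ^ 2 := by
          rw [← sq_abs c, ← Real.rpow_natCast, ← Real.rpow_add_of_nonneg (abs_nonneg _)
            (by linarith) (by positivity)]
          congr 1; push_cast; ring
      _ ≤ |u z.1 - u z.2| ^ (p - 2) * ((u z.1 - u z.2) * c) := by gcongr
      _ = _ := by ring
  -- Domination by the kernel of `u` gives integrability, without which the Bochner integral in the
  -- pairing could not be read as a lower integral.
  have hup : ∀ z : RN N × RN N, |u z.1 - u z.2| ^ (p - 2) * (u z.1 - u z.2) *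
        (posTrunc u h z.1 - posTrunc u h z.2) ≤ |u z.1 - u z.2| ^ p := by
    intro z
    have h1 := abs_posTrunc_sub_le u h z.1 z.2
    set c := posTrunc u h z.1 - posTrunc u h z.2
    calc |u z.1 - u z.2| ^ (p - 2) * (u z.1 - u z.2) * c
        = |u z.1 - u z.2| ^ (p - 2) * ((u z.1 - u z.2) * c) := by ring
      _ ≤ |u z.1 - u z.2| ^ (p - 2) * |u z.1 - u z.2| ^ 2 := by
        gcongr
        calc (u z.1 - u z.2) * c ≤ |(u z.1 - u z.2) * c| := le_abs_self _
          _ = |u z.1 - u z.2| * |c| := abs_mul _ _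
          _ ≤ |u z.1 - u z.2| * |u z.1 - u z.2| := by gcongr
          _ = _ := by ring
      _ = |u z.1 - u z.2| ^ p := by
        rw [← Real.rpow_natCast, ← Real.rpow_add_of_nonneg (abs_nonneg _)
            (by linarith) (by positivity)]
        congr 1; push_cast; ring
  have h0 : ∀ z : RN N × RN N, 0 ≤ |u z.1 - u z.2| ^ (p - 2) * (u z.1 - u z.2) *
        (posTrunc u h z.1 - posTrunc u h z.2) / ‖z.1 - z.2‖ ^ ((N : ℝ) + s * p) := fun z =>
    div_nonneg ((by positivity : (0 : ℝ) ≤ _).trans (hlow z)) (by positivity)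
  have hmeas : AEMeasurable (fun z : RN N × RN N => |u z.1 - u z.2| ^ (p - 2) * (u z.1 - u z.2) *
        (posTrunc u h z.1 - posTrunc u h z.2) / ‖z.1 - z.2‖ ^ ((N : ℝ) + s * p))
      (volume.prod volume) := by
    have m1 : AEMeasurable (fun z : RN N × RN N => u z.1) (volume.prod volume) := hum.comp_fst
    have m2 : AEMeasurable (fun z : RN N × RN N => u z.2) (volume.prod volume) := hum.comp_snd
    have m3 : AEMeasurable (fun z : RN N × RN N => posTrunc u h z.1) (volume.prod volume) :=
      hwm.comp_fst
    have m4 : AEMeasurable (fun z : RN N × RN N => posTrunc u h z.2) (volume.prod volume) :=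
      hwm.comp_snd
    refine AEMeasurable.div ((((m1.sub m2).abs.pow_const _).mul (m1.sub m2)).mul (m3.sub m4)) ?_
    exact (((measurable_fst.sub measurable_snd).norm).pow_const _).aemeasurable
  have hfin := (gagliardo_lt_top_iff hp0).1 hu.2
  have hint : Integrable (fun z : RN N × RN N => |u z.1 - u z.2| ^ (p - 2) * (u z.1 - u z.2) *
        (posTrunc u h z.1 - posTrunc u h z.2) / ‖z.1 - z.2‖ ^ ((N : ℝ) + s * p))
      (volume.prod volume) := by
    refine ⟨hmeas.aestronglyMeasurable, ?_⟩
    rw [hasFiniteIntegral_iff_ofReal (Filter.Eventually.of_forall h0)]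
    refine lt_of_le_of_lt (lintegral_mono fun z => ?_) hfin
    unfold gagliardoKernel
    have := hup z
    gcongr
  rw [fracPLaplacePairing, ofReal_integral_eq_lintegral_ofReal hint
    (Filter.Eventually.of_forall h0)]
  refine lintegral_mono fun z => ?_
  unfold gagliardoKernel
  have := hlow z
  gcongr

theorem IsWeakSolution.lintegral_gagliardoKernel_le {N : ℕ} {s p : ℝ} (hp : 2 ≤ p)
    {f : RN N → ℝ → ℝ} {u : RN N → ℝ} (hu : IsWeakSolution N s p f u) {h : ℝ} (hh : 0 ≤ h) :
    ∫⁻ z, gagliardoKernel N s p (posTrunc u h) z ∂(volume.prod volume) ≤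
      ∫⁻ x, ‖f x (u x) * posTrunc u h x‖ₑ := by
  refine (lintegral_gagliardoKernel_posTrunc_le hp hu.1 h).trans ?_
  rw [(hu.2 _ (hu.1.posTrunc (by linarith) hh)).2]
  exact (Real.ofReal_le_enorm _).trans (enorm_integral_le_lintegral_enorm _)

/-! ### Estimate of the source term. -/

/-- Writing `z = max (a - h) k`, one has `a ≤ z + 2 * k ≤ 3 * z`, and `z ≥ k` trades the missing
powers of `z` for powers of `k`. Both source terms thus become homogeneous of degree `p` in `z`. -/
theorem rpow_mul_posTrunc_bounds {p a h k : ℝ} (hp : 1 ≤ p) (hk : 0 < k) (hh : 0 ≤ h)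
    (hhk : h ≤ 2 * k) (ha : h < a) :
    a ^ (p - 1) * (a - h) ≤ 4 ^ p * max (a - h) k ^ p ∧
      a - h ≤ k ^ (1 - p) * max (a - h) k ^ p := by
  set z := max (a - h) k with hz
  have hzk : k ≤ z := le_max_right _ _
  have hza : a - h ≤ z := le_max_left _ _
  have hz0 : 0 < z := hk.trans_le hzk
  have ha0 : 0 < a := by linarith
  constructor
  · calc a ^ (p - 1) * (a - h) ≤ (4 * z) ^ (p - 1) * (4 * z) := by
          gcongr <;> linarith
      _ = (4 * z) ^ p := by
        rw [← Real.rpow_add_one (by positivity)]; congr 1; ring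
      _ = _ := Real.mul_rpow (by norm_num) hz0.le
  · calc a - h ≤ z := hza
      _ = z ^ (1 - p) * z ^ p := by rw [← Real.rpow_add hz0]; simp
      _ ≤ k ^ (1 - p) * z ^ p := by
        gcongr ?_ * _
        exact Real.rpow_le_rpow_of_nonpos hk hzk (by linarith)

/-- Bound for the right-hand side tested with `(u - h)_+`, in terms of the measure of the
superlevel set `{u > h}` and the `L^P` norm of `(u - h)_+`. -/
theorem lintegral_source_mul_posTrunc_le {α : Type*} [MeasurableSpace α] {μ : Measure α}
    {p r P σ τ δ h k : ℝ} {n : ℝ≥0∞} {f : α → ℝ → ℝ} {u b₂ b₃ : α → ℝ}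
    (hp : 1 ≤ p) (hr : 0 < r) (hδ : 0 ≤ δ) (hτ : 0 ≤ τ) (hτ1 : τ ≤ 1) (hσ : 0 < σ)
    (hστ : σ + τ = 1) (hδr : 1 / r + δ = σ) (hPτ : P * τ = p)
    (hu : AEMeasurable u μ) (hb₂ : AEMeasurable b₂ μ) (hn : n ≠ ∞) (hb₃ : ∀ᵐ x ∂μ, ‖b₃ x‖ₑ ≤ n)
    (hf : ∀ᵐ x ∂μ, ∀ t : ℝ, |f x t| ≤ b₂ x * |t| ^ (p - 1) + b₃ x)
    (hk : 0 < k) (hh : 0 ≤ h) (hhk : h ≤ 2 * k) :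
    ∫⁻ x, ‖f x (u x) * posTrunc u h x‖ₑ ∂μ ≤
      (ENNReal.ofReal (4 ^ p) * (∫⁻ x, ‖b₂ x‖ₑ ^ r ∂μ) ^ (1 / r) * μ {x | h < u x} ^ δ +
        n * ENNReal.ofReal (k ^ (1 - p)) * μ {x | h < u x} ^ σ) *
      ((∫⁻ x, ‖posTrunc u h x‖ₑ ^ P ∂μ) ^ τ +
        ENNReal.ofReal (k ^ p) * μ {x | h < u x} ^ τ) := by
  set A := {x | h < u x} with hA
  have hAm : NullMeasurableSet A μ := nullMeasurableSet_lt aemeasurable_const hu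
  set Z : α → ℝ≥0∞ := fun x => max ‖posTrunc u h x‖ₑ (ENNReal.ofReal k) with hZ
  have hZm : AEMeasurable Z μ := (aemeasurable_posTrunc hu h).enorm.max aemeasurable_const
  have hp0 : 0 < p := by linarith
  have hpt : ∀ᵐ x ∂μ, ‖f x (u x) * posTrunc u h x‖ₑ ≤
      A.indicator (fun x => ENNReal.ofReal (4 ^ p) * (‖b₂ x‖ₑ * Z x ^ p) +
        n * ENNReal.ofReal (k ^ (1 - p)) * Z x ^ p) x := by
    filter_upwards [hf, hb₃] with x hfx hbx
    by_cases hx : x ∈ A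
    · have hx' : h < u x := hx
      have hw : posTrunc u h x = u x - h := max_eq_left (by linarith)
      obtain ⟨h1, h2⟩ := rpow_mul_posTrunc_bounds hp hk hh hhk hx'
      have hZx : Z x ^ p = ENNReal.ofReal (max (u x - h) k ^ p) := by
        rw [← ENNReal.ofReal_rpow_of_nonneg (by positivity) hp0.le, ENNReal.ofReal_max,
          ← Real.enorm_of_nonneg (by linarith : 0 ≤ u x - h), ← hw]
      rw [Set.indicator_of_mem hx]
      have hreal : |f x (u x) * (u x - h)| ≤
          |b₂ x| * (4 ^ p * max (u x - h) k ^ p) +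
            |b₃ x| * (k ^ (1 - p) * max (u x - h) k ^ p) := by
        have h3 := hfx (u x)
        rw [abs_of_pos (by linarith : 0 < u x)] at h3
        have hu0 : 0 < u x := by linarith
        rw [abs_mul, abs_of_pos (by linarith : 0 < u x - h)]
        calc |f x (u x)| * (u x - h) ≤ (|b₂ x| * u x ^ (p - 1) + |b₃ x|) * (u x - h) := by
              refine mul_le_mul_of_nonneg_right (h3.trans ?_) (by linarith)
              gcongr
              · exact le_abs_self _
              · exact le_abs_self _
          _ = |b₂ x| * (u x ^ (p - 1) * (u x - h)) + |b₃ x| * (u x - h) := by ring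
          _ ≤ _ := by gcongr
      rw [hw, ← ofReal_norm, Real.norm_eq_abs]
      refine (ENNReal.ofReal_le_ofReal hreal).trans ?_
      rw [ENNReal.ofReal_add (by positivity) (by positivity), ENNReal.ofReal_mul (abs_nonneg _),
        ENNReal.ofReal_mul (abs_nonneg _), ENNReal.ofReal_mul (by positivity),
        ENNReal.ofReal_mul (by positivity), ← hZx, ← Real.enorm_eq_ofReal_abs,
        ← Real.enorm_eq_ofReal_abs]
      rw [mul_left_comm, mul_assoc n]
      gcongr
    · have hw : posTrunc u h x = 0 := max_eq_right (by
        have : ¬ h < u x := hx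
        linarith)
      simp [hw]
  have hZP : (∫⁻ x in A, Z x ^ P ∂μ) ^ τ ≤
      (∫⁻ x, ‖posTrunc u h x‖ₑ ^ P ∂μ) ^ τ + ENNReal.ofReal (k ^ p) * μ A ^ τ := by
    have h1 : ∫⁻ x in A, Z x ^ P ∂μ ≤
        ∫⁻ x, ‖posTrunc u h x‖ₑ ^ P ∂μ + ENNReal.ofReal k ^ P * μ A := by
      calc ∫⁻ x in A, Z x ^ P ∂μ
          ≤ ∫⁻ x in A, (‖posTrunc u h x‖ₑ ^ P + ENNReal.ofReal k ^ P) ∂μ := by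
            refine lintegral_mono fun x => ?_
            simp only [hZ]
            rcases max_cases ‖posTrunc u h x‖ₑ (ENNReal.ofReal k) with ⟨h1, _⟩ | ⟨h1, _⟩ <;> rw [h1]
            · exact le_self_add
            · exact le_add_self
        _ = ∫⁻ x in A, ‖posTrunc u h x‖ₑ ^ P ∂μ + ENNReal.ofReal k ^ P * μ A := by
            rw [lintegral_add_right _ measurable_const, setLIntegral_const]
        _ ≤ _ := by gcongr; exact Measure.restrict_le_self
    calc _ ≤ (∫⁻ x, ‖posTrunc u h x‖ₑ ^ P ∂μ + ENNReal.ofReal k ^ P * μ A) ^ τ := by gcongr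
      _ ≤ (∫⁻ x, ‖posTrunc u h x‖ₑ ^ P ∂μ) ^ τ + (ENNReal.ofReal k ^ P * μ A) ^ τ :=
        ENNReal.rpow_add_le_add_rpow _ _ hτ hτ1
      _ = _ := by
        rw [ENNReal.mul_rpow_of_nonneg _ _ hτ, ← ENNReal.rpow_mul, hPτ,
          ENNReal.ofReal_rpow_of_pos hk]
  have hH1 := lintegral_mul_rpow_le_measure_univ (μ := μ.restrict A) hb₂.enorm.restrict
    hZm.restrict hr hδ hτ (by rw [hδr, hστ]) hPτ
  have hH2 := lintegral_rpow_le_measure_univ (μ := μ.restrict A) hZm.restrict hσ hτ hστ hPτ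
  rw [Measure.restrict_apply_univ] at hH1 hH2
  calc ∫⁻ x, ‖f x (u x) * posTrunc u h x‖ₑ ∂μ
      ≤ ∫⁻ x, A.indicator (fun x => ENNReal.ofReal (4 ^ p) * (‖b₂ x‖ₑ * Z x ^ p) +
          n * ENNReal.ofReal (k ^ (1 - p)) * Z x ^ p) x ∂μ := lintegral_mono_ae hpt
    _ = ENNReal.ofReal (4 ^ p) * (∫⁻ x in A, ‖b₂ x‖ₑ * Z x ^ p ∂μ) +
          n * ENNReal.ofReal (k ^ (1 - p)) * ∫⁻ x in A, Z x ^ p ∂μ := by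
      rw [lintegral_indicator₀ hAm, lintegral_add_right' _
        ((hZm.pow_const p).restrict.const_mul _), lintegral_const_mul' _ _ (by simp),
        lintegral_const_mul' _ _ (ENNReal.mul_ne_top hn (by simp))]
    _ ≤ ENNReal.ofReal (4 ^ p) * ((∫⁻ x, ‖b₂ x‖ₑ ^ r ∂μ) ^ (1 / r) * μ A ^ δ *
            ((∫⁻ x, ‖posTrunc u h x‖ₑ ^ P ∂μ) ^ τ + ENNReal.ofReal (k ^ p) * μ A ^ τ)) +
          n * ENNReal.ofReal (k ^ (1 - p)) * (μ A ^ σ *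
            ((∫⁻ x, ‖posTrunc u h x‖ₑ ^ P ∂μ) ^ τ + ENNReal.ofReal (k ^ p) * μ A ^ τ)) := by
      gcongr
      · refine hH1.trans ?_
        gcongr
        exact Measure.restrict_le_self
      · exact hH2.trans (by gcongr)
    _ = _ := by ring

/-! ### De Giorgi iteration. -/

theorem measure_superlevel_rpow_mul_le {α : Type*} [MeasurableSpace α] {μ : Measure α}
    {p P τ h d : ℝ} {u : α → ℝ} (hP : 0 < P) (hτ : 0 ≤ τ) (hPτ : P * τ = p)
    (hu : AEMeasurable u μ) (hd : 0 < d) :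
    μ {x | h + d < u x} ^ τ * ENNReal.ofReal (d ^ p) ≤
      (∫⁻ x, ‖posTrunc u h x‖ₑ ^ P ∂μ) ^ τ := by
  have h1 : ENNReal.ofReal d ^ P * μ {x | h + d < u x} ≤ ∫⁻ x, ‖posTrunc u h x‖ₑ ^ P ∂μ := by
    refine le_trans ?_ (mul_meas_ge_le_lintegral₀ ((aemeasurable_posTrunc hu h).enorm.pow_const P)
      (ENNReal.ofReal d ^ P))
    gcongr
    intro hx
    rename_i x
    refine ENNReal.rpow_le_rpow ?_ hP.le
    have hx' : h + d < u x := hx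
    rw [posTrunc, Real.enorm_of_nonneg (le_max_right _ _)]
    exact ENNReal.ofReal_le_ofReal (le_max_of_le_left (by linarith))
  have h2 := ENNReal.rpow_le_rpow h1 hτ
  rwa [ENNReal.mul_rpow_of_nonneg _ _ hτ, ← ENNReal.rpow_mul, hPτ, ENNReal.ofReal_rpow_of_pos hd,
    mul_comm] at h2

/-- Geometric decay for a superlinear De Giorgi recursion with a small initial value. -/
theorem le_pow_mul_of_superlinear_recursion {a : ℕ → ℝ≥0∞} {A B c b ρ : ℝ≥0∞} {δ σ τ : ℝ}
    (hδ : 0 < δ) (hδσ : δ ≤ σ) (hτ : 0 < τ) (hρ : ρ ≤ 1) (hbρ : b * ρ ^ δ ≤ 1)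
    (hrec : ∀ j, a (j + 1) ^ τ ≤ c * b ^ j * (A * a j ^ δ + B * a j ^ σ) * a j ^ τ)
    (hsmall : c * (A * a 0 ^ δ + B * a 0 ^ σ) ≤ ρ ^ τ) (j : ℕ) :
    a j ≤ ρ ^ j * a 0 := by
  have hσ : 0 < σ := hδ.trans_le hδσ
  induction j with
  | zero => simp
  | succ j ih =>
    -- As `ρ ≤ 1` and `δ ≤ σ`, the weaker gain `ρ ^ δ` per step serves for both terms.
    have hE : A * a j ^ δ + B * a j ^ σ ≤ (ρ ^ δ) ^ j * (A * a 0 ^ δ + B * a 0 ^ σ) := by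
      have h1 : a j ^ δ ≤ (ρ ^ δ) ^ j * a 0 ^ δ := by
        calc a j ^ δ ≤ (ρ ^ j * a 0) ^ δ := ENNReal.rpow_le_rpow ih hδ.le
          _ = _ := by
            rw [ENNReal.mul_rpow_of_nonneg _ _ hδ.le, ← ENNReal.rpow_natCast,
              ← ENNReal.rpow_natCast, ← ENNReal.rpow_mul, ← ENNReal.rpow_mul, mul_comm δ]
      have h2 : a j ^ σ ≤ (ρ ^ δ) ^ j * a 0 ^ σ := by
        calc a j ^ σ ≤ (ρ ^ j * a 0) ^ σ := ENNReal.rpow_le_rpow ih hσ.le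
          _ = (ρ ^ σ) ^ j * a 0 ^ σ := by
            rw [ENNReal.mul_rpow_of_nonneg _ _ hσ.le, ← ENNReal.rpow_natCast,
              ← ENNReal.rpow_natCast, ← ENNReal.rpow_mul, ← ENNReal.rpow_mul, mul_comm σ]
          _ ≤ _ := by
            gcongr ?_ ^ j * _
            exact ENNReal.rpow_le_rpow_of_exponent_ge hρ hδσ
      calc _ ≤ A * ((ρ ^ δ) ^ j * a 0 ^ δ) + B * ((ρ ^ δ) ^ j * a 0 ^ σ) := by gcongr
        _ = _ := by ring
    rw [← ENNReal.rpow_le_rpow_iff hτ]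
    calc a (j + 1) ^ τ ≤ c * b ^ j * (A * a j ^ δ + B * a j ^ σ) * a j ^ τ := hrec j
      _ ≤ c * b ^ j * ((ρ ^ δ) ^ j * (A * a 0 ^ δ + B * a 0 ^ σ)) * (ρ ^ j * a 0) ^ τ := by
        gcongr
      _ = (b * ρ ^ δ) ^ j * (c * (A * a 0 ^ δ + B * a 0 ^ σ)) * (ρ ^ j * a 0) ^ τ := by
        rw [mul_pow]; ring
      _ ≤ 1 ^ j * ρ ^ τ * (ρ ^ j * a 0) ^ τ := by gcongr
      _ = (ρ ^ (j + 1) * a 0) ^ τ := by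
        rw [one_pow, one_mul, ← ENNReal.mul_rpow_of_nonneg _ _ hτ.le]; congr 1; ring

/-- Absorption: `e * X` is at most half of `X`, and finiteness of `X` permits the subtraction. -/
theorem le_two_mul_of_le_mul_add {X Y e : ℝ≥0∞} (hX : X ≠ ∞) (he : 2 * e ≤ 1)
    (h : X ≤ e * (X + Y)) : X ≤ 2 * e * Y := by
  have h1 : X + X ≤ X + 2 * e * Y := by
    calc X + X = 2 * X := (two_mul X).symm
      _ ≤ 2 * (e * (X + Y)) := by gcongr
      _ = 2 * e * X + 2 * e * Y := by ring
      _ ≤ 1 * X + 2 * e * Y := by gcongr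
      _ = _ := by rw [one_mul]
  exact (ENNReal.add_le_add_iff_left hX).1 h1

/-- De Giorgi iteration on superlevel sets: if the superlevel set at height `k` is small enough,
then the solution does not exceed `2 k`. -/
theorem IsWeakSolution.measure_superlevel_eq_zero {N : ℕ} {s p r P σ τ δ k : ℝ} {n : ℝ≥0∞}
    {S : ℝ≥0} {f : RN N → ℝ → ℝ} {u b₂ b₃ : RN N → ℝ}
    (hp : 2 ≤ p) (hr : 0 < r) (hP : 0 < P) (hδ : 0 < δ) (hτ : 0 < τ) (hσ : 0 < σ)
    (hστ : σ + τ = 1) (hδr : 1 / r + δ = σ) (hPτ : P * τ = p)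
    (hS : ∀ w : RN N → ℝ, AEMeasurable w → (∫⁻ y, ‖w y‖ₑ ^ P) ≠ ∞ →
      (∫⁻ y, ‖w y‖ₑ ^ P) ^ τ ≤ S * ∫⁻ z, gagliardoKernel N s p w z ∂(volume.prod volume))
    (hsol : IsWeakSolution N s p f u) (huP : (∫⁻ y, ‖u y‖ₑ ^ P) ≠ ∞)
    (hb₂ : AEMeasurable b₂) (hn : n ≠ ∞)
    (hb₃ : ∀ᵐ x ∂(volume : Measure (RN N)), ‖b₃ x‖ₑ ≤ n)
    (hf : ∀ᵐ x ∂(volume : Measure (RN N)), ∀ t : ℝ, |f x t| ≤ b₂ x * |t| ^ (p - 1) + b₃ x)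
    (hk : 0 < k) (hfin : volume {x | k < u x} ≠ ∞)
    (hsmall : 2 * 2 ^ p * S *
      (ENNReal.ofReal (4 ^ p) * (∫⁻ x, ‖b₂ x‖ₑ ^ r) ^ (1 / r) * volume {x | k < u x} ^ δ +
        n * ENNReal.ofReal (k ^ (1 - p)) * volume {x | k < u x} ^ σ) ≤
      ((2 : ℝ≥0∞) ^ (-(p / δ))) ^ τ) :
    volume {x | 2 * k < u x} = 0 := by
  have hp0 : 0 < p := by linarith
  have hum : AEMeasurable u := hsol.1.1.1.aemeasurable
  set A : ℝ≥0∞ := ENNReal.ofReal (4 ^ p) * (∫⁻ x, ‖b₂ x‖ₑ ^ r) ^ (1 / r)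
  set B : ℝ≥0∞ := n * ENNReal.ofReal (k ^ (1 - p))
  -- Chosen so that `2 ^ p * ρ ^ δ = 1`: the gain in the measures exactly offsets the loss `2 ^ p`
  -- per step from halving the level gaps.
  set ρ : ℝ≥0∞ := (2 : ℝ≥0∞) ^ (-(p / δ)) with hρ
  have hρ1 : ρ < 1 := by
    rw [hρ, ENNReal.rpow_neg]
    exact ENNReal.inv_lt_one.2 (ENNReal.one_lt_rpow (by norm_num) (by positivity))
  -- Levels rising from `k` towards `2 * k`, with gaps `k * 2⁻¹ ^ (j + 1)`.
  set ℓ : ℕ → ℝ := fun j => k * (2 - (2 : ℝ)⁻¹ ^ j) with hℓ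
  have hpow : ∀ j : ℕ, 0 < (2 : ℝ)⁻¹ ^ j ∧ (2 : ℝ)⁻¹ ^ j ≤ 1 := fun j =>
    ⟨by positivity, pow_le_one₀ (by norm_num) (by norm_num)⟩
  have hℓk : ∀ j, k ≤ ℓ j ∧ ℓ j ≤ 2 * k := by
    intro j
    have := hpow j
    simp only [hℓ]
    constructor <;> nlinarith
  set a : ℕ → ℝ≥0∞ := fun j => volume {x | ℓ j < u x} with ha
  have ha0 : a 0 = volume {x | k < u x} := by
    have : ℓ 0 = k := by simp only [hℓ]; norm_num
    simp only [ha, this]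
  have haa : ∀ j, a j ≤ a 0 := by
    intro j
    rw [ha0]
    exact measure_mono fun x (hx : ℓ j < u x) => lt_of_le_of_lt (hℓk j).1 hx
  rw [← ha0] at hsmall hfin
  have hdecay : ∀ j, a (j + 1) ^ τ ≤
      2 * 2 ^ p * S * ((2 : ℝ≥0∞) ^ p) ^ j * (A * a j ^ δ + B * a j ^ σ) * a j ^ τ := by
    intro j
    set E := A * a j ^ δ + B * a j ^ σ with hE
    have hσ0 := hσ.le
    have hEE : E ≤ A * a 0 ^ δ + B * a 0 ^ σ := by
      have := haa j
      rw [hE]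
      gcongr
    -- Smallness at level `0` also provides absorption at every level, since the measures decrease
    -- and `ρ ^ τ ≤ 1`.
    have hSE : 2 * (S * E) ≤ 1 := by
      calc 2 * (S * E) ≤ 2 * (1 * S * (A * a 0 ^ δ + B * a 0 ^ σ)) := by
            rw [one_mul]; gcongr
        _ ≤ 2 * (2 ^ p * S * (A * a 0 ^ δ + B * a 0 ^ σ)) := by
          gcongr
          exact ENNReal.one_le_rpow (by norm_num) hp0
        _ = 2 * 2 ^ p * S * (A * a 0 ^ δ + B * a 0 ^ σ) := by ring
        _ ≤ ρ ^ τ := hsmall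
        _ ≤ 1 := ENNReal.rpow_le_one hρ1.le hτ.le
    have hℓ0 : 0 ≤ ℓ j := hk.le.trans (hℓk j).1
    set X := ∫⁻ y, ‖posTrunc u (ℓ j) y‖ₑ ^ P with hX
    have hXt : X ≠ ∞ := by
      refine ne_top_of_le_ne_top huP (lintegral_mono fun y => ?_)
      refine ENNReal.rpow_le_rpow ?_ hP.le
      rw [enorm_le_iff_norm_le, Real.norm_eq_abs, Real.norm_eq_abs, posTrunc,
        abs_of_nonneg (le_max_right _ _)]
      exact max_le (by linarith [le_abs_self (u y)]) (abs_nonneg _)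
    have hXle : X ^ τ ≤ S * E * (X ^ τ + ENNReal.ofReal (k ^ p) * a j ^ τ) := by
      calc X ^ τ ≤ S * _ := hS _ (aemeasurable_posTrunc hum _) hXt
        _ ≤ S * (E * (X ^ τ + ENNReal.ofReal (k ^ p) * a j ^ τ)) := by
          gcongr
          refine (hsol.lintegral_gagliardoKernel_le hp hℓ0).trans ?_
          exact lintegral_source_mul_posTrunc_le (by linarith) hr hδ.le hτ.le (by linarith) hσ
            hστ hδr hPτ hum hb₂ hn hb₃ hf hk hℓ0 (hℓk j).2
        _ = _ := by ring
    have hX2 := le_two_mul_of_le_mul_add (ENNReal.rpow_ne_top_of_nonneg hτ.le hXt) hSE hXle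
    have hd : 0 < k * (2 : ℝ)⁻¹ ^ (j + 1) := by positivity
    have hcheb := (measure_superlevel_rpow_mul_le (h := ℓ j) hP hτ.le hPτ hum hd).trans hX2
    have hstep : ℓ j + k * (2 : ℝ)⁻¹ ^ (j + 1) = ℓ (j + 1) := by
      simp only [hℓ]; ring
    rw [hstep] at hcheb
    have hkd : ENNReal.ofReal ((k * (2 : ℝ)⁻¹ ^ (j + 1)) ^ p) * ((2 : ℝ≥0∞) ^ p) ^ (j + 1) =
        ENNReal.ofReal (k ^ p) := by
      have e : ((2 : ℝ≥0∞) ^ p) ^ (j + 1) = ENNReal.ofReal (((2 : ℝ) ^ (j + 1)) ^ p) := by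
        rw [← ENNReal.ofReal_rpow_of_pos (by positivity), ENNReal.ofReal_pow (by norm_num),
          ← ENNReal.rpow_natCast, ← ENNReal.rpow_natCast, ← ENNReal.rpow_mul, ← ENNReal.rpow_mul,
          mul_comm p, ENNReal.ofReal_ofNat]
      rw [e, ← ENNReal.ofReal_mul (by positivity), ← Real.mul_rpow hd.le (by positivity), mul_assoc,
        ← mul_pow]
      norm_num
    have hk0 : ENNReal.ofReal (k ^ p) ≠ 0 := by
      simpa using Real.rpow_pos_of_pos hk p
    refine (ENNReal.mul_le_mul_iff_left hk0 ENNReal.ofReal_ne_top).1 ?_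
    calc a (j + 1) ^ τ * ENNReal.ofReal (k ^ p)
        = a (j + 1) ^ τ * ENNReal.ofReal ((k * (2 : ℝ)⁻¹ ^ (j + 1)) ^ p) *
            ((2 : ℝ≥0∞) ^ p) ^ (j + 1) := by rw [mul_assoc, hkd]
      _ ≤ 2 * (S * E) * (ENNReal.ofReal (k ^ p) * a j ^ τ) * ((2 : ℝ≥0∞) ^ p) ^ (j + 1) := by
        gcongr
      _ = _ := by rw [pow_succ]; ring
  have hbρ : (2 : ℝ≥0∞) ^ p * ρ ^ δ ≤ 1 := by
    rw [hρ, ← ENNReal.rpow_mul, ← ENNReal.rpow_add _ _ (by norm_num) (by norm_num)]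
    rw [show p + -(p / δ) * δ = 0 by field_simp; ring, ENNReal.rpow_zero]
  have hgeo := le_pow_mul_of_superlinear_recursion hδ
    (by have : 0 < 1 / r := by positivity
        linarith) hτ hρ1.le hbρ hdecay hsmall
  have hlim : Filter.Tendsto (fun j : ℕ => ρ ^ j * a 0) Filter.atTop (nhds 0) := by
    have := ENNReal.Tendsto.mul_const (ENNReal.tendsto_pow_atTop_nhds_zero_of_lt_one hρ1)
      (Or.inr hfin)
    simpa using this
  refine nonpos_iff_eq_zero.1 (ge_of_tendsto' hlim fun j => ?_)
  refine le_trans ?_ (hgeo j)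
  exact measure_mono fun x (hx : 2 * k < u x) => lt_of_le_of_lt (hℓk j).2 hx

/-! ### Choice of the starting height. -/

theorem IsWeakSolution.neg {N : ℕ} {s p : ℝ} {f : RN N → ℝ → ℝ} {u : RN N → ℝ}
    (hu : IsWeakSolution N s p f u) :
    IsWeakSolution N s p (fun x t => -f x (-t)) (fun x => -u x) := by
  refine ⟨⟨hu.1.1.neg, ?_⟩, fun v hv => ?_⟩
  · have : gagliardo N s p (fun x => -u x) = gagliardo N s p u := by
      unfold gagliardo
      congr 2
      ext z
      rw [neg_sub_neg, abs_sub_comm]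
    rw [this]
    exact hu.1.2
  · obtain ⟨h1, h2⟩ := hu.2 v hv
    have hpair : fracPLaplacePairing N s p (fun x => -u x) v = -fracPLaplacePairing N s p u v := by
      unfold fracPLaplacePairing
      rw [← integral_neg]
      congr 1
      ext z
      rw [neg_sub_neg, abs_sub_comm]
      ring
    simp only [neg_neg, neg_mul]
    exact ⟨h1.neg, by rw [hpair, h2, integral_neg]⟩

/-- With `M = ‖u‖_β`, height `K * T` and `α` the superlevel measure, Chebyshev gives `α ≤ (M / (K *
T)) ^ β`. In the first bound `M ≤ T` suffices. In the second, the factor `T ^ (1 - p)` is paid for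
by `hMT'`. Lowering the resulting powers of `K` to `K ^ (p * δ)`, via `K ≥ 1` and `p ≤ β`, removes
`β` from the requirement on `K`. -/
theorem measure_mul_rpow_le_one {K T M α : ℝ≥0∞} {p β σ δ : ℝ} (hK : 1 ≤ K)
    (hT0 : T ≠ 0) (hTt : T ≠ ∞) (hMT : M ≤ T) (hMT' : M ^ (β * σ) ≤ T ^ (β * σ + (p - 1)))
    (hα : (K * T) ^ β * α ≤ M ^ β) (hp : 1 ≤ p) (hpβ : p ≤ β) (hδ : 0 < δ) (hδσ : δ ≤ σ) :
    α ^ δ * K ^ (p * δ) ≤ 1 ∧ (K * T) ^ (1 - p) * α ^ σ * K ^ (p * δ) ≤ 1 := by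
  have hσ : 0 < σ := hδ.trans_le hδσ
  have hβ : 0 < β := by linarith
  constructor
  · have h1 : K ^ β * α ≤ 1 := by
      have hTβ0 : T ^ β ≠ 0 := (ENNReal.rpow_pos (pos_iff_ne_zero.2 hT0) hTt).ne'
      have hTβt : T ^ β ≠ ∞ := ENNReal.rpow_ne_top_of_nonneg hβ.le hTt
      refine (ENNReal.mul_le_mul_iff_left hTβ0 hTβt).1 ?_
      calc K ^ β * α * T ^ β = (K * T) ^ β * α := by
            rw [ENNReal.mul_rpow_of_nonneg _ _ hβ.le]; ring
        _ ≤ M ^ β := hα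
        _ ≤ 1 * T ^ β := by rw [one_mul]; gcongr
    calc α ^ δ * K ^ (p * δ) = (K ^ p * α) ^ δ := by
          rw [ENNReal.mul_rpow_of_nonneg _ _ hδ.le, ← ENNReal.rpow_mul, mul_comm]
      _ ≤ (K ^ β * α) ^ δ := by gcongr
      _ ≤ 1 := ENNReal.rpow_le_one h1 hδ.le
  · have hβσ : 0 < β * σ := by positivity
    have hT1 : T ^ (β * σ) ≠ 0 := (ENNReal.rpow_pos (pos_iff_ne_zero.2 hT0) hTt).ne'
    have hT2 : T ^ (β * σ) ≠ ∞ := ENNReal.rpow_ne_top_of_nonneg hβσ.le hTt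
    have h1 : α ^ σ * K ^ (β * σ) ≤ T ^ (p - 1) := by
      refine (ENNReal.mul_le_mul_iff_left hT1 hT2).1 ?_
      calc α ^ σ * K ^ (β * σ) * T ^ (β * σ) = ((K * T) ^ β * α) ^ σ := by
            rw [ENNReal.mul_rpow_of_nonneg _ _ hσ.le, ← ENNReal.rpow_mul,
              ENNReal.mul_rpow_of_nonneg _ _ hβσ.le]
            ring
        _ ≤ (M ^ β) ^ σ := ENNReal.rpow_le_rpow hα hσ.le
        _ = M ^ (β * σ) := by rw [ENNReal.rpow_mul]
        _ ≤ T ^ (β * σ + (p - 1)) := hMT'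
        _ = T ^ (p - 1) * T ^ (β * σ) := by rw [ENNReal.rpow_add _ _ hT0 hTt, mul_comm]
    have h2 : (K * T) ^ (1 - p) ≤ T ^ (1 - p) := by
      rw [← neg_sub p 1, ENNReal.rpow_neg, ENNReal.rpow_neg, ENNReal.inv_le_inv]
      refine ENNReal.rpow_le_rpow ?_ (by linarith)
      exact le_mul_of_one_le_left' hK
    have h3 : K ^ (p * δ) ≤ K ^ (β * σ) :=
      ENNReal.rpow_le_rpow_of_exponent_le hK (by gcongr)
    calc (K * T) ^ (1 - p) * α ^ σ * K ^ (p * δ) ≤ T ^ (1 - p) * α ^ σ * K ^ (β * σ) := by gcongr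
      _ = T ^ (1 - p) * (α ^ σ * K ^ (β * σ)) := by ring
      _ ≤ T ^ (1 - p) * T ^ (p - 1) := by gcongr
      _ = 1 := by rw [← ENNReal.rpow_add _ _ hT0 hTt]; simp

/-- The truncation height, relative to the size of the solution, at which the De Giorgi iteration
starts. -/
noncomputable def startingFactor (Λ : ℝ≥0) (p δ : ℝ) (m n : ℝ≥0) : ℝ≥0 :=
  (Λ * ((4 : ℝ≥0) ^ p * m + n) + 1) ^ (1 / (p * δ))

theorem startingFactor_mono {Λ : ℝ≥0} {p δ : ℝ} (hpδ : 0 < p * δ) {m m' n n' : ℝ≥0}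
    (hm : m ≤ m') (hn : n ≤ n') : startingFactor Λ p δ m n ≤ startingFactor Λ p δ m' n' := by
  unfold startingFactor
  gcongr

theorem one_le_startingFactor {Λ : ℝ≥0} {p δ : ℝ} (hpδ : 0 < p * δ) (m n : ℝ≥0) :
    1 ≤ startingFactor Λ p δ m n :=
  NNReal.one_le_rpow (le_add_of_nonneg_left zero_le) (by positivity)

theorem startingFactor_rpow {Λ : ℝ≥0} {p δ : ℝ} (hpδ : 0 < p * δ) (m n : ℝ≥0) :
    startingFactor Λ p δ m n ^ (p * δ) = Λ * ((4 : ℝ≥0) ^ p * m + n) + 1 := by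
  rw [startingFactor, ← NNReal.rpow_mul, one_div_mul_cancel hpδ.ne', NNReal.rpow_one]

/-- One-sided bound for weak solutions by a multiple of `max ‖u‖_β (‖u‖_β ^ θ)`. -/
theorem IsWeakSolution.ae_le_startingFactor {N : ℕ} {s p r P σ τ δ β θ : ℝ} {m n : ℝ≥0}
    {S Λ : ℝ≥0} {f : RN N → ℝ → ℝ} {u b₂ b₃ : RN N → ℝ}
    (hp : 2 ≤ p) (hr : 0 < r) (hP : 0 < P) (hδ : 0 < δ) (hτ : 0 < τ) (hσ : 0 < σ)
    (hστ : σ + τ = 1) (hδr : 1 / r + δ = σ) (hPτ : P * τ = p) (hpβ : p < β)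
    (hθ : θ * (β * σ + (p - 1)) = β * σ)
    (hS : ∀ w : RN N → ℝ, AEMeasurable w → (∫⁻ y, ‖w y‖ₑ ^ P) ≠ ∞ →
      (∫⁻ y, ‖w y‖ₑ ^ P) ^ τ ≤ S * ∫⁻ z, gagliardoKernel N s p w z ∂(volume.prod volume))
    (hΛ : 2 * 2 ^ p * (S : ℝ≥0∞) ≤ ((2 : ℝ≥0∞) ^ (-(p / δ))) ^ τ * Λ)
    (hsol : IsWeakSolution N s p f u) (huP : (∫⁻ y, ‖u y‖ₑ ^ P) ≠ ∞)
    (hb₂ : AEMeasurable b₂) (hm : (∫⁻ x, ‖b₂ x‖ₑ ^ r) ^ (1 / r) ≤ m)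
    (hb₃ : ∀ᵐ x ∂(volume : Measure (RN N)), ‖b₃ x‖ₑ ≤ n)
    (hf : ∀ᵐ x ∂(volume : Measure (RN N)), ∀ t : ℝ, |f x t| ≤ b₂ x * |t| ^ (p - 1) + b₃ x)
    (hu0 : eLpNorm u (ENNReal.ofReal β) volume ≠ 0)
    (hut : eLpNorm u (ENNReal.ofReal β) volume ≠ ∞) :
    ∀ᵐ x, ENNReal.ofReal (u x) ≤ 2 * startingFactor Λ p δ m n *
      max (eLpNorm u (ENNReal.ofReal β) volume) (eLpNorm u (ENNReal.ofReal β) volume ^ θ) := by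
  have hp0 : 0 < p := by linarith
  have hβ : 0 < β := by linarith
  have hpδ : 0 < p * δ := by positivity
  have hγ : 0 < β * σ + (p - 1) := by
    have : 0 < β * σ := by positivity
    linarith
  have hθ0 : 0 ≤ θ := by
    rw [← eq_div_iff hγ.ne'] at hθ
    rw [hθ]; positivity
  set M := eLpNorm u (ENNReal.ofReal β) volume with hM
  set T := max M (M ^ θ) with hT
  set K : ℝ≥0 := startingFactor Λ p δ m n with hK
  have hK1 : (1 : ℝ≥0∞) ≤ K := by exact_mod_cast one_le_startingFactor hpδ m n
  have hMT : M ≤ T := le_max_left _ _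
  have hT0 : T ≠ 0 := ((pos_iff_ne_zero.2 hu0).trans_le hMT).ne'
  have hTt : T ≠ ∞ := by
    rw [hT, ← lt_top_iff_ne_top]
    exact max_lt hut.lt_top (ENNReal.rpow_lt_top_of_nonneg hθ0 hut)
  have hMT' : M ^ (β * σ) ≤ T ^ (β * σ + (p - 1)) := by
    calc M ^ (β * σ) = (M ^ θ) ^ (β * σ + (p - 1)) := by rw [← ENNReal.rpow_mul, hθ]
      _ ≤ _ := by gcongr; exact le_max_right _ _
  have hKT0 : (K : ℝ≥0∞) * T ≠ 0 := mul_ne_zero (one_pos.trans_le hK1).ne' hT0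
  have hKTt : (K : ℝ≥0∞) * T ≠ ∞ := ENNReal.mul_ne_top ENNReal.coe_ne_top hTt
  set k : ℝ := (K * T).toReal with hk
  have hk0 : 0 < k := ENNReal.toReal_pos hKT0 hKTt
  have hkof : ENNReal.ofReal k = K * T := ENNReal.ofReal_toReal hKTt
  set α := volume {x | k < u x} with hα
  have hβof : ENNReal.ofReal β ≠ 0 := by simpa using hβ
  have hcheb : ((K : ℝ≥0∞) * T) ^ β * α ≤ M ^ β := by
    have h := mul_meas_ge_le_pow_eLpNorm' volume hβof ENNReal.ofReal_ne_top hsol.1.1.1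
      ((K : ℝ≥0∞) * T)
    rw [ENNReal.toReal_ofReal hβ.le] at h
    refine le_trans ?_ h
    gcongr
    rw [hα]
    refine measure_mono fun x hx => ?_
    have hx' : k < u x := hx
    change (K : ℝ≥0∞) * T ≤ ‖u x‖ₑ
    rw [← hkof]
    exact (ENNReal.ofReal_le_ofReal hx'.le).trans (Real.ofReal_le_enorm _)
  have hαt : α ≠ ∞ := by
    intro hα'
    rw [hα', ENNReal.mul_top (ENNReal.rpow_pos (pos_iff_ne_zero.2 hKT0) hKTt).ne', top_le_iff]
      at hcheb
    exact ENNReal.rpow_ne_top_of_nonneg hβ.le hut hcheb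
  obtain ⟨hs1, hs2⟩ := measure_mul_rpow_le_one hK1 hT0 hTt hMT hMT' hcheb
    (by linarith) hpβ.le hδ (by
      have : 0 < 1 / r := by positivity
      linarith)
  -- Multiplying the smallness condition by `L` cancels all dependence on `α` and `T`; what remains
  -- is `Λ * (4 ^ p * m + n) ≤ L`, which the definition of `startingFactor` ensures.
  set L : ℝ≥0∞ := (K : ℝ≥0∞) ^ (p * δ) with hL
  have hLeq : L = Λ * (ENNReal.ofReal (4 ^ p) * m + n) + 1 := by
    rw [hL, ← ENNReal.coe_rpow_of_nonneg _ hpδ.le, startingFactor_rpow hpδ,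
      ← ENNReal.ofReal_rpow_of_pos (by norm_num), ENNReal.ofReal_ofNat]
    push_cast
    rw [ENNReal.coe_rpow_of_nonneg _ hp0.le]
    rfl
  have hL0 : L ≠ 0 := by rw [hLeq]; simp
  have hLt : L ≠ ∞ := ENNReal.rpow_ne_top_of_nonneg hpδ.le ENNReal.coe_ne_top
  have hzero : volume {x | 2 * k < u x} = 0 := by
    refine hsol.measure_superlevel_eq_zero hp hr hP hδ hτ hσ hστ hδr hPτ hS huP hb₂
      (n := n) ENNReal.coe_ne_top hb₃ hf hk0 hαt ?_
    rw [← ENNReal.ofReal_rpow_of_pos hk0, hkof]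
    refine (ENNReal.mul_le_mul_iff_left hL0 hLt).1 ?_
    set R : ℝ≥0∞ := ((2 : ℝ≥0∞) ^ (-(p / δ))) ^ τ
    calc 2 * 2 ^ p * S * (ENNReal.ofReal (4 ^ p) * (∫⁻ x, ‖b₂ x‖ₑ ^ r) ^ (1 / r) * α ^ δ +
          n * (K * T) ^ (1 - p) * α ^ σ) * L
        = 2 * 2 ^ p * S * (ENNReal.ofReal (4 ^ p) * (∫⁻ x, ‖b₂ x‖ₑ ^ r) ^ (1 / r) * (α ^ δ * L) +
          n * ((K * T) ^ (1 - p) * α ^ σ * L)) := by ring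
      _ ≤ R * Λ * (ENNReal.ofReal (4 ^ p) * m * 1 + n * 1) := by gcongr
      _ = R * (Λ * (ENNReal.ofReal (4 ^ p) * m + n)) := by ring
      _ ≤ R * L := by
        rw [hLeq]
        gcongr
        exact le_self_add
  have hae : ∀ᵐ x, u x ≤ 2 * k := by
    rw [ae_iff]
    simpa only [not_le] using hzero
  filter_upwards [hae] with x hx
  refine (ENNReal.ofReal_le_ofReal hx).trans ?_
  rw [ENNReal.ofReal_mul (by norm_num), hkof, ENNReal.ofReal_ofNat, mul_assoc]

/-! ### Fixing the exponents and constants. -/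

theorem theorem1p1 (N : ℕ) (s p : ℝ) (hs0 : 0 < s) (hs1 : s < 1) (hp : 2 ≤ p)
    (hpN : p < (N : ℝ) / s) :
    ∃ θ₀ : ℝ → ℝ, (∀ β : ℝ, p < β → 0 < θ₀ β ∧ θ₀ β ≤ 1) ∧
      ∀ q : ℝ, (N : ℝ) / s < q →
        ∃ C : ℝ≥0 → ℝ≥0 → ℝ≥0,
          (∀ m m' n n' : ℝ≥0, m ≤ m' → n ≤ n' → C m n ≤ C m' n') ∧
          ∀ β : ℝ, p < β →
          ∀ (b₂ b₃ : RN N → ℝ) (f : RN N → ℝ → ℝ) (u : RN N → ℝ),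
            MemLp b₂ (ENNReal.ofReal (q / p)) volume →
            MemLp b₃ (ENNReal.ofReal (β / (p - 1))) volume →
            MemLp b₃ ∞ volume →
            (∀ᵐ x ∂(volume : Measure (RN N)), ∀ t : ℝ,
              |f x t| ≤ b₂ x * |t| ^ (p - 1) + b₃ x) →
            IsWeakSolution N s p f u →
            MemLp u (ENNReal.ofReal β) volume →
            eLpNorm u ∞ volume ≤
              (C (eLpNorm b₂ (ENNReal.ofReal (q / p)) volume).toNNReal
                 (eLpNorm b₃ (ENNReal.ofReal (β / (p - 1))) volume
                    + eLpNorm b₃ ∞ volume).toNNReal : ℝ≥0∞) *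
                max (eLpNorm u (ENNReal.ofReal β) volume)
                  (eLpNorm u (ENNReal.ofReal β) volume ^ θ₀ β) := by
  have hp0 : 0 < p := by linarith
  have hNr : (0 : ℝ) < N := by
    have : 0 < (N : ℝ) / s := by linarith
    exact (div_pos_iff_of_pos_right hs0).1 this
  have hN : 0 < N := by exact_mod_cast hNr
  have hspN : s * p < N := by rwa [lt_div_iff₀ hs0, mul_comm] at hpN
  obtain ⟨σ, hσdef⟩ : ∃ σ : ℝ, σ = s * p / N := ⟨_, rfl⟩
  obtain ⟨τ, hτdef⟩ : ∃ τ : ℝ, τ = 1 - σ := ⟨_, rfl⟩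
  set P := critExp N s p with hPdef
  have hσ : 0 < σ := by rw [hσdef]; positivity
  have hσN : σ * N = s * p := by rw [hσdef]; field_simp
  have hτ : 0 < τ := by
    rw [hτdef, hσdef, sub_pos, div_lt_one hNr]; exact hspN
  have hστ : σ + τ = 1 := by rw [hτdef]; ring
  have hNsp : 0 < (N : ℝ) - s * p := by linarith
  have hP : 0 < P := by rw [hPdef, critExp]; positivity
  have hPτ : P * τ = p := by
    rw [hτdef, hσdef, hPdef, critExp, one_sub_div hNr.ne', div_mul_div_comm,
      mul_comm ((N : ℝ) - s * p), mul_div_mul_right _ _ hNsp.ne', mul_div_cancel_left₀ _ hNr.ne']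
  obtain ⟨S, hS⟩ := exists_fractional_sobolev hN hs0 (by linarith) hP hσ hτ hστ hPτ hσN
  have hγ : ∀ β : ℝ, p < β → 0 < β * σ ∧ 0 < β * σ + (p - 1) := by
    intro β hβ
    have : 0 < β * σ := mul_pos (by linarith) hσ
    exact ⟨this, by linarith⟩
  -- The exponent for which `(M ^ θ) ^ (β * σ + (p - 1)) = M ^ (β * σ)`, as needed for the `b₃`
  -- term.
  refine ⟨fun β => β * σ / (β * σ + (p - 1)), fun β hβ => ?_, fun q hq => ?_⟩
  · obtain ⟨h1, h2⟩ := hγ β hβ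
    exact ⟨div_pos h1 h2, by rw [div_le_one h2]; linarith⟩
  have hq0 : 0 < q := by linarith
  have hr : 0 < q / p := by positivity
  obtain ⟨δ, hδdef⟩ : ∃ δ : ℝ, δ = σ - 1 / (q / p) := ⟨_, rfl⟩
  have hδ : 0 < δ := by
    rw [div_lt_iff₀ hs0] at hq
    rw [hδdef, sub_pos, one_div_div, hσdef, div_lt_div_iff₀ hq0 hNr]
    nlinarith
  have hδr : 1 / (q / p) + δ = σ := by rw [hδdef]; ring
  set R : ℝ≥0∞ := ((2 : ℝ≥0∞) ^ (-(p / δ))) ^ τ with hR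
  have hR' : (2 : ℝ≥0∞) ^ (-(p / δ)) ≠ ∞ := ENNReal.rpow_ne_top_of_ne_zero (by simp) (by simp)
  have hR0 : R ≠ 0 :=
    (ENNReal.rpow_pos (ENNReal.rpow_pos (by norm_num) (by norm_num)) hR').ne'
  have hRt : R ≠ ∞ := ENNReal.rpow_ne_top_of_nonneg hτ.le hR'
  have hΛt : 2 * 2 ^ p * (S : ℝ≥0∞) / R ≠ ∞ := by
    refine ENNReal.div_ne_top (ENNReal.mul_ne_top (ENNReal.mul_ne_top (by simp) ?_)
      ENNReal.coe_ne_top) hR0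
    exact ENNReal.rpow_ne_top_of_nonneg hp0.le (by simp)
  set Λ : ℝ≥0 := (2 * 2 ^ p * (S : ℝ≥0∞) / R).toNNReal with hΛ
  have hΛle : 2 * 2 ^ p * (S : ℝ≥0∞) ≤ R * Λ := by
    rw [hΛ, ENNReal.coe_toNNReal hΛt, ENNReal.mul_div_cancel hR0 hRt]
  have hpδ : 0 < p * δ := by positivity
  refine ⟨fun m n => 2 * startingFactor Λ p δ m n,
    fun m m' n n' hm hn => mul_le_mul_right (startingFactor_mono hpδ hm hn) 2, ?_⟩
  intro β hβ b₂ b₃ f u hb₂ hb₃ hb₃' hf hsol hu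
  obtain ⟨hβσ, hβσ'⟩ := hγ β hβ
  have hβ0 : 0 < β := by linarith
  -- The starting height would be `0` here, so the case `u = 0` a.e. is separate.
  by_cases hu0 : eLpNorm u (ENNReal.ofReal β) volume = 0
  · have hz : u =ᵐ[volume] 0 :=
      (eLpNorm_eq_zero_iff hu.1 (by simpa using hβ0)).1 hu0
    rw [eLpNorm_congr_ae hz, eLpNorm_zero]
    exact zero_le
  set m : ℝ≥0 := (eLpNorm b₂ (ENNReal.ofReal (q / p)) volume).toNNReal with hm
  set n : ℝ≥0 := (eLpNorm b₃ (ENNReal.ofReal (β / (p - 1))) volume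
    + eLpNorm b₃ ∞ volume).toNNReal with hn
  have hm' : (∫⁻ x, ‖b₂ x‖ₑ ^ (q / p)) ^ (1 / (q / p)) ≤ m := by
    rw [hm, ENNReal.coe_toNNReal hb₂.2.ne, eLpNorm_eq_lintegral_rpow_enorm_toReal
      (by simpa using hr) ENNReal.ofReal_ne_top, ENNReal.toReal_ofReal hr.le]
  have hn' : ∀ᵐ x ∂(volume : Measure (RN N)), ‖b₃ x‖ₑ ≤ n := by
    filter_upwards [enorm_ae_le_eLpNormEssSup b₃ volume] with x hx
    rw [hn, ENNReal.coe_toNNReal (ENNReal.add_ne_top.2 ⟨hb₃.2.ne, hb₃'.2.ne⟩)]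
    refine hx.trans ?_
    rw [eLpNorm_exponent_top]
    exact le_add_self
  have huP : (∫⁻ y, ‖u y‖ₑ ^ P) ≠ ∞ := by
    have := lintegral_rpow_enorm_lt_top_of_eLpNorm_lt_top (by simpa using hP)
      ENNReal.ofReal_ne_top hsol.1.1.2
    rw [ENNReal.toReal_ofReal hP.le] at this
    exact this.ne
  have hθ : β * σ / (β * σ + (p - 1)) * (β * σ + (p - 1)) = β * σ := div_mul_cancel₀ _ hβσ'.ne'
  have hupper := hsol.ae_le_startingFactor hp hr hP hδ hτ hσ hστ hδr hPτ hβ hθ hS hΛle huP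
    hb₂.1.aemeasurable hm' hn' hf hu0 hu.2.ne
  have hnorm : eLpNorm (fun x => -u x) (ENNReal.ofReal β) volume =
      eLpNorm u (ENNReal.ofReal β) volume := eLpNorm_neg u _ _
  have hlower := hsol.neg.ae_le_startingFactor hp hr hP hδ hτ hσ hστ hδr hPτ hβ hθ hS hΛle
    (by simpa using huP) hb₂.1.aemeasurable hm' hn'
    (hf.mono fun x hx t => by simpa using hx (-t)) (by rwa [hnorm]) (by rw [hnorm]; exact hu.2.ne)
  rw [hnorm] at hlower
  rw [eLpNorm_exponent_top]
  refine eLpNormEssSup_le_of_ae_enorm_bound ?_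
  filter_upwards [hupper, hlower] with x h1 h2
  rw [ENNReal.coe_mul, ENNReal.coe_ofNat]
  rcases le_total 0 (u x) with h | h
  · rwa [Real.enorm_of_nonneg h]
  · rwa [← enorm_neg, Real.enorm_of_nonneg (by linarith)]
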